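/- Let $r(0),r(1),r(2),\dots$ be any sequence of integers such that $r(0)=1$ and $r(m)\le r(m+1)\le r(m)+1$ for all $m\ge 0$ (so that $1\le r(m)\le m+1$). Let $X_1,X_2,\dots$ be i.i.d. random variables with the exponential distribution $\mathrm{Exp}(1)$; $X_n$ is the value of candidate $n$. The candidates are examined one by one. When $m\ge 0$ candidates have been accepted so far, the next candidate is accepted if and only if her value exceeds the threshold $Y_m$, where $Y_m$ is the $r(m)$-th largest of the $m$ values already accepted, interpreted as $Y_m:=0$ when $r(m)=m+1$. Let $N_m$ be the index of the $m$-th accepted candidate ($m\ge 1$). Then almost surely $N_m<\infty$ for all $m$, and $$N_m=r(m)\,e^{Y_m+O_p(1)},\qquad m\ge 1.$$ That is, the sequence $Z_m:=\log N_m-\log r(m)-Y_m$, $m\ge1$, is stochastically bounded (tight): $$\sup_{m\ge 1}\mathbb P\bigl(|Z_m|>K\bigr)\to 0\qquad\text{as }K\to\infty .$$ -/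

import Mathlib

open MeasureTheory ProbabilityTheory Filter Topology

noncomputable section

namespace Hiring

/-- The sequences `r` that define a rank-based hiring strategy. -/
structure IsAdmissible (r : ℕ → ℕ) : Prop where
  zero : r 0 = 1
  le_succ : ∀ m, r m ≤ r (m + 1)
  succ_le : ∀ m, r (m + 1) ≤ r m + 1

/-- The `k`-th largest element (`k ≥ 1`, counted with multiplicity) of a finite multiset of
reals, interpreted as `0` if there are fewer than `k` elements. -/
def kthLargest (S : Multiset ℝ) (k : ℕ) : ℝ :=
  (S.sort (· ≥ ·)).getD (k - 1) 0

/-- Given the multiset `S` of the values accepted so far, the threshold that the next accepted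
value has to exceed: the `r m`-th largest element of `S`, where `m` is the number of elements
of `S` (and `0` if `r m = m + 1`). -/
def thresholdOf (r : ℕ → ℕ) (S : Multiset ℝ) : ℝ :=
  kthLargest S (r S.card)

/-- The state of the hiring process at the `m`-th acceptance, when the values of the candidates
are `x 0, x 1, x 2, …`: candidate number `n` (where `n = 1, 2, …`) has value `x (n - 1)`.
The first component is the number of the `m`-th accepted candidate (`0` if `m = 0`), the second
one is the multiset of the first `m` accepted values.
If the last accepted candidate has number `N`, the later candidates have the values
`x N, x (N + 1), …`, and the first of these that exceeds the threshold is accepted. -/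
def state (r : ℕ → ℕ) (x : ℕ → ℝ) : ℕ → ℕ × Multiset ℝ
  | 0 => (0, 0)
  | m + 1 =>
    let N := (state r x m).1
    let S := (state r x m).2
    let i := sInf {i : ℕ | N ≤ i ∧ thresholdOf r S < x i}
    (i + 1, x i ::ₘ S)

/-- `N_m`: the number of the `m`-th accepted candidate (candidates are numbered from `1`). -/
def hireIndex (r : ℕ → ℕ) (x : ℕ → ℝ) (m : ℕ) : ℕ := (state r x m).1

/-- `Y_m`: the threshold after `m` acceptances. -/
def threshold (r : ℕ → ℕ) (x : ℕ → ℝ) (m : ℕ) : ℝ := thresholdOf r (state r x m).2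

/-- The family `Z` of real random variables is stochastically bounded (tight), `Z = O_p(1)`:
`sup_i P(|Z_i| > K) → 0` as `K → ∞`. -/
def StochasticallyBounded {Ω ι : Type*} [MeasurableSpace Ω] (P : Measure Ω)
    (Z : ι → Ω → ℝ) : Prop :=
  Tendsto (fun K : ℝ => ⨆ i, P {ω | K < |Z i ω|}) atTop (𝓝 0)

end Hiring

end

noncomputable section

namespace Hiring

/-! Every candidate seen so far whose value exceeds the current threshold has been accepted, so
`Y_m` is the `r m`-th largest of all `N_m` values seen (`le_threshold_iff`). Hence a candidate is
accepted exactly when her rank among those seen is at most `r m`, and the event `N_m = n` depends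
only on the relative order of the first `n` values (`acceptedCount_congr`).

For i.i.d. values without atoms, relative order and order statistics are independent
(`pi_inter_eq_mul`). So conditioning on `N_m = n` leaves the law of the `r m`-th largest of `n`
exponentials unchanged. Markov and Chebyshev put it within `K` of `log n - log (r m)`, up to
probability `5 * exp (-K)`, uniformly in `n` (`measure_deviationSet_le`). Summing over the disjoint
events `N_m = n` gives the same bound for `Z_m`, uniformly in `m`. -/

/-! ### The `k`-th largest element through counting -/

theorem le_getD_iff_of_pairwise_ge {t : ℝ} (ht : 0 < t) (l : List ℝ)
    (hl : l.Pairwise (· ≥ ·)) (k : ℕ) :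
    t ≤ l.getD k 0 ↔ k < (l.filter (t ≤ ·)).length := by
  induction l generalizing k with
  | nil => simp [ht]
  | cons a l ih =>
    rw [List.pairwise_cons] at hl
    by_cases hta : t ≤ a
    · cases k with
      | zero => simp [hta]
      | succ k =>
        have := ih hl.2 k
        simpa [hta] using this
    · have h0 : (a :: l).filter (t ≤ ·) = [] := by
        rw [List.filter_eq_nil_iff]
        intro b hb
        rcases List.mem_cons.1 hb with rfl | hb
        · simpa using hta
        · have := hl.1 b hb
          simp only [decide_eq_true_eq, not_le]
          push Not at hta
          exact lt_of_le_of_lt this hta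
      rw [h0]
      simp only [List.length_nil, not_lt_zero, iff_false, not_le]
      by_cases hk : k < (a :: l).length
      · rw [List.getD_eq_getElem _ _ hk]
        have := List.filter_eq_nil_iff.1 h0 _ (List.getElem_mem hk)
        simpa using this
      · rw [List.getD_eq_default _ _ (not_lt.1 hk)]
        exact ht

/-- Positivity of `t` makes the default value `0` harmless: with fewer than `k` elements both sides
fail. -/
theorem le_kthLargest_iff (S : Multiset ℝ) {k : ℕ} (hk : 1 ≤ k) {t : ℝ} (ht : 0 < t) :
    t ≤ kthLargest S k ↔ k ≤ (S.filter (t ≤ ·)).card := by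
  have h := le_getD_iff_of_pairwise_ge ht (S.sort (· ≥ ·)) (S.pairwise_sort (· ≥ ·)) (k - 1)
  have hS : S.filter (t ≤ ·) = ((S.sort (· ≥ ·)).filter (t ≤ ·) : List ℝ) := by
    conv_lhs => rw [← S.sort_eq (· ≥ ·)]
    rw [Multiset.filter_coe]
  rw [hS, Multiset.coe_card, kthLargest, h]
  omega

theorem kthLargest_nonneg {S : Multiset ℝ} (hS : ∀ s ∈ S, 0 ≤ s) (k : ℕ) :
    0 ≤ kthLargest S k := by
  unfold kthLargest
  by_cases hk : k - 1 < (S.sort (· ≥ ·)).length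
  · rw [List.getD_eq_getElem _ _ hk]
    exact hS _ ((Multiset.mem_sort _).1 (List.getElem_mem hk))
  · rw [List.getD_eq_default _ _ (not_lt.1 hk)]

/-! ### Acceptance by relative rank -/

theorem IsAdmissible.one_le {r : ℕ → ℕ} (hr : IsAdmissible r) (m : ℕ) : 1 ≤ r m := by
  induction m with
  | zero => exact hr.zero.ge
  | succ m ih => exact ih.trans (hr.le_succ m)

theorem IsAdmissible.le_add_one {r : ℕ → ℕ} (hr : IsAdmissible r) (m : ℕ) : r m ≤ m + 1 := by
  induction m with
  | zero => exact hr.zero.le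
  | succ m ih => exact (hr.succ_le m).trans (by omega)

/-- The number of accepted candidates among the first `n`, in terms of relative ranks only. -/
def acceptedCount (r : ℕ → ℕ) (x : ℕ → ℝ) : ℕ → ℕ
  | 0 => 0
  | n + 1 => acceptedCount r x n +
      if ((Finset.range n).filter (fun i => x n ≤ x i)).card < r (acceptedCount r x n)
      then 1 else 0

theorem acceptedCount_le_succ (r : ℕ → ℕ) (x : ℕ → ℝ) (n : ℕ) :
    acceptedCount r x n ≤ acceptedCount r x (n + 1) := by
  rw [acceptedCount]; omega

theorem acceptedCount_mono (r : ℕ → ℕ) (x : ℕ → ℝ) : Monotone (acceptedCount r x) :=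
  monotone_nat_of_le_succ (acceptedCount_le_succ r x)

theorem acceptedCount_le (r : ℕ → ℕ) (x : ℕ → ℝ) (n : ℕ) : acceptedCount r x n ≤ n := by
  induction n with
  | zero => rfl
  | succ n ih => rw [acceptedCount]; split_ifs <;> omega

theorem acceptedCount_congr (r : ℕ → ℕ) {x y : ℕ → ℝ} (n : ℕ)
    (h : ∀ i < n, ∀ j < n, x i ≤ x j ↔ y i ≤ y j) :
    acceptedCount r x n = acceptedCount r y n := by
  induction n with
  | zero => rfl
  | succ n ih =>
    have hf : (Finset.range n).filter (fun i => x n ≤ x i) =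
        (Finset.range n).filter (fun i => y n ≤ y i) := by
      apply Finset.filter_congr
      intro i hi
      exact h n (by omega) i (by have := Finset.mem_range.1 hi; omega)
    rw [acceptedCount, acceptedCount, hf, ih fun i hi j hj => h i (by omega) j (by omega)]

/-- The `0`-based position of the first candidate accepted after the `m`-th acceptance. -/
def nextHire (r : ℕ → ℕ) (x : ℕ → ℝ) (m : ℕ) : ℕ :=
  sInf {i : ℕ | hireIndex r x m ≤ i ∧ threshold r x m < x i}

theorem hireIndex_succ (r : ℕ → ℕ) (x : ℕ → ℝ) (m : ℕ) :
    hireIndex r x (m + 1) = nextHire r x m + 1 := rfl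

theorem state_snd_succ (r : ℕ → ℕ) (x : ℕ → ℝ) (m : ℕ) :
    (state r x (m + 1)).2 = x (nextHire r x m) ::ₘ (state r x m).2 := rfl

theorem card_state (r : ℕ → ℕ) (x : ℕ → ℝ) (m : ℕ) : (state r x m).2.card = m := by
  induction m with
  | zero => rfl
  | succ m ih => rw [state_snd_succ, Multiset.card_cons, ih]

theorem threshold_eq (r : ℕ → ℕ) (x : ℕ → ℝ) (m : ℕ) :
    threshold r x m = kthLargest (state r x m).2 (r m) := by
  rw [threshold, thresholdOf, card_state]

/-! ### Pathwise description of the threshold -/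

section Paths

variable {r : ℕ → ℕ} {x : ℕ → ℝ}

theorem pos_of_mem_state (hpos : ∀ i, 0 < x i) (m : ℕ) : ∀ s ∈ (state r x m).2, 0 < s := by
  induction m with
  | zero => intro s hs; exact absurd hs (Multiset.notMem_zero s)
  | succ m ih =>
    intro s hs
    rw [state_snd_succ, Multiset.mem_cons] at hs
    rcases hs with rfl | hs
    · exact hpos _
    · exact ih s hs

theorem threshold_nonneg (hpos : ∀ i, 0 < x i) (m : ℕ) : 0 ≤ threshold r x m := by
  rw [threshold_eq]
  exact kthLargest_nonneg (fun s hs => (pos_of_mem_state hpos m s hs).le) _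

/-- Unboundedness of every tail of `x` rules out the junk value `sInf ∅ = 0`. -/
theorem nextHire_mem (hx : ∀ (N : ℕ) (c : ℝ), ∃ i, N ≤ i ∧ c < x i) (m : ℕ) :
    hireIndex r x m ≤ nextHire r x m ∧ threshold r x m < x (nextHire r x m) :=
  Nat.sInf_mem (s := {i : ℕ | hireIndex r x m ≤ i ∧ threshold r x m < x i}) (hx _ _)

theorem le_threshold_of_lt_nextHire {m j : ℕ} (hj : hireIndex r x m ≤ j)
    (hj' : j < nextHire r x m) : x j ≤ threshold r x m := by
  by_contra h
  exact Nat.notMem_of_lt_sInf hj' ⟨hj, not_le.1 h⟩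

/-- The new value exceeds the old threshold, so the number of accepted values at or above that
threshold grows by one, while `r` grows by at most one. -/
theorem threshold_le_succ (hr : IsAdmissible r) (hpos : ∀ i, 0 < x i)
    (hx : ∀ (N : ℕ) (c : ℝ), ∃ i, N ≤ i ∧ c < x i) (m : ℕ) :
    threshold r x m ≤ threshold r x (m + 1) := by
  by_contra! h
  have ht : 0 < threshold r x m := (threshold_nonneg hpos (m + 1)).trans_lt h
  have h1 : r m ≤ ((state r x m).2.filter (threshold r x m ≤ ·)).card := by
    rw [← le_kthLargest_iff _ (hr.one_le m) ht, ← threshold_eq]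
  refine absurd h (not_lt.2 ?_)
  rw [threshold_eq r x (m + 1), le_kthLargest_iff _ (hr.one_le _) ht, state_snd_succ,
    Multiset.filter_cons_of_pos _ (nextHire_mem hx m).2.le, Multiset.card_cons]
  exact (hr.succ_le m).trans (Nat.succ_le_succ h1)

/-- The accepted values come from distinct earlier candidates, among them all those who exceed the
current threshold. -/
theorem exists_accepted (hr : IsAdmissible r) (hpos : ∀ i, 0 < x i)
    (hx : ∀ (N : ℕ) (c : ℝ), ∃ i, N ≤ i ∧ c < x i) (m : ℕ) :
    ∃ I ⊆ Finset.range (hireIndex r x m), (state r x m).2 = I.val.map x ∧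
      ∀ i < hireIndex r x m, threshold r x m < x i → i ∈ I := by
  induction m with
  | zero => exact ⟨∅, by simp, rfl, fun i hi => absurd hi (Nat.not_lt_zero i)⟩
  | succ m ih =>
    obtain ⟨I, hI, hS, hmem⟩ := ih
    have hn := nextHire_mem (r := r) hx m
    have hnot : nextHire r x m ∉ I := fun h => by
      have := Finset.mem_range.1 (hI h); omega
    refine ⟨insert (nextHire r x m) I, ?_, ?_, ?_⟩
    · intro i hi
      rw [hireIndex_succ, Finset.mem_range]
      rcases Finset.mem_insert.1 hi with rfl | hi
      · omega
      · have := Finset.mem_range.1 (hI hi); omega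
    · rw [state_snd_succ, Finset.insert_val_of_notMem hnot, Multiset.map_cons, hS]
    · intro i hi hlt
      rw [hireIndex_succ] at hi
      have hlt' := (threshold_le_succ hr hpos hx m).trans_lt hlt
      rcases (Nat.lt_succ_iff.1 hi).eq_or_lt with rfl | hi'
      · exact Finset.mem_insert_self _ _
      · refine Finset.mem_insert_of_mem (hmem i ?_ hlt')
        by_contra! h
        exact absurd hlt' (not_lt.2 (le_threshold_of_lt_nextHire h hi'))

/-- Until the next acceptance, the threshold is the `r m`-th largest of all values seen. -/
theorem le_threshold_iff (hr : IsAdmissible r) (hpos : ∀ i, 0 < x i)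
    (hx : ∀ (N : ℕ) (c : ℝ), ∃ i, N ≤ i ∧ c < x i) {m n : ℕ} (hn : hireIndex r x m ≤ n)
    (hn' : n ≤ nextHire r x m) {t : ℝ} (ht : 0 < t) :
    t ≤ threshold r x m ↔ r m ≤ ((Finset.range n).filter (fun i => t ≤ x i)).card := by
  obtain ⟨I, hI, hS, hmem⟩ := exists_accepted hr hpos hx m
  have hcard : ((state r x m).2.filter (t ≤ ·)).card = (I.filter (fun i => t ≤ x i)).card := by
    rw [hS, Multiset.filter_map, Multiset.card_map]
    rfl
  have key : t ≤ threshold r x m ↔ r m ≤ (I.filter (fun i => t ≤ x i)).card := by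
    rw [threshold_eq, le_kthLargest_iff _ (hr.one_le m) ht, hcard]
  constructor
  · intro h
    refine (key.1 h).trans (Finset.card_le_card (Finset.filter_subset_filter _ fun i hi => ?_))
    have := Finset.mem_range.1 (hI hi)
    exact Finset.mem_range.2 (by omega)
  · intro h
    -- If the threshold were below `t`, every seen value at least `t` would exceed it and so belong
    -- to `I`.
    by_contra! hlt
    refine absurd (key.2 (h.trans (Finset.card_le_card fun i hi => ?_))) (not_le.2 hlt)
    obtain ⟨hi, hti⟩ := Finset.mem_filter.1 hi
    have hi := Finset.mem_range.1 hi
    refine Finset.mem_filter.2 ⟨hmem i ?_ (hlt.trans_le hti), hti⟩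
    by_contra! h'
    exact absurd (hlt.trans_le hti) (not_lt.2 (le_threshold_of_lt_nextHire h' (by omega)))

/-- This matches the threshold rule with the rank rule: take `t = x n` in `le_threshold_iff`. -/
theorem acceptedCount_succ_eq (hr : IsAdmissible r) (hpos : ∀ i, 0 < x i)
    (hx : ∀ (N : ℕ) (c : ℝ), ∃ i, N ≤ i ∧ c < x i) {m n : ℕ} (hn : hireIndex r x m ≤ n)
    (hn' : n ≤ nextHire r x m) (hc : acceptedCount r x n = m) :
    acceptedCount r x (n + 1) = m + if threshold r x m < x n then 1 else 0 := by
  have h := le_threshold_iff hr hpos hx hn hn' (hpos n)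
  rw [acceptedCount, hc]
  congr 2
  rw [← not_le, ← not_le, h]

theorem acceptedCount_of_le_nextHire (hr : IsAdmissible r) (hpos : ∀ i, 0 < x i)
    (hx : ∀ (N : ℕ) (c : ℝ), ∃ i, N ≤ i ∧ c < x i) {m n : ℕ} (hn : hireIndex r x m ≤ n)
    (hn' : n ≤ nextHire r x m) (hc : acceptedCount r x (hireIndex r x m) = m) :
    acceptedCount r x n = m := by
  induction n, hn using Nat.le_induction with
  | base => exact hc
  | succ n hn ih =>
    rw [acceptedCount_succ_eq hr hpos hx hn (by omega) (ih (by omega)),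
      if_neg (not_lt.2 (le_threshold_of_lt_nextHire hn (by omega))), add_zero]

theorem acceptedCount_hireIndex (hr : IsAdmissible r) (hpos : ∀ i, 0 < x i)
    (hx : ∀ (N : ℕ) (c : ℝ), ∃ i, N ≤ i ∧ c < x i) (m : ℕ) :
    acceptedCount r x (hireIndex r x m) = m := by
  induction m with
  | zero => rfl
  | succ m ih =>
    have hn := nextHire_mem (r := r) hx m
    rw [hireIndex_succ, acceptedCount_succ_eq hr hpos hx hn.1 le_rfl
      (acceptedCount_of_le_nextHire hr hpos hx hn.1 le_rfl ih), if_pos hn.2]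

theorem acceptedCount_nextHire (hr : IsAdmissible r) (hpos : ∀ i, 0 < x i)
    (hx : ∀ (N : ℕ) (c : ℝ), ∃ i, N ≤ i ∧ c < x i) (m : ℕ) :
    acceptedCount r x (nextHire r x m) = m :=
  acceptedCount_of_le_nextHire hr hpos hx (nextHire_mem hx m).1 le_rfl
    (acceptedCount_hireIndex hr hpos hx m)

end Paths

/-! ### Independence of relative ranks and order statistics -/

theorem measurePreserving_comp_perm {ι : Type*} [Fintype ι] (ν : Measure ℝ) [SigmaFinite ν]
    (σ : Equiv.Perm ι) :
    MeasurePreserving (fun x : ι → ℝ => x ∘ σ) (Measure.pi fun _ => ν) (Measure.pi fun _ => ν) := by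
  have h := measurePreserving_piCongrLeft (fun _ : ι => ν) σ.symm
  have he : ⇑(MeasurableEquiv.piCongrLeft (fun _ : ι => ℝ) σ.symm) = fun x => x ∘ σ := by
    ext x i
    have := Equiv.piCongrLeft_apply_apply (fun _ : ι => ℝ) σ.symm x (σ i)
    rwa [Equiv.symm_apply_apply] at this
  rwa [he] at h

theorem ae_injective_pi {ι : Type*} [Fintype ι] (ν : Measure ℝ) [IsProbabilityMeasure ν]
    [NullSingletonClass ν] : ∀ᵐ x ∂(Measure.pi fun _ : ι => ν), Function.Injective x := by
  have h : ∀ i j : ι, i ≠ j → ∀ᵐ x ∂(Measure.pi fun _ : ι => ν), x i ≠ x j := by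
    intro i j hij
    have hind : IndepFun (fun x : ι → ℝ => x i) (fun x => x j) (Measure.pi fun _ => ν) :=
      (iIndepFun_pi (X := fun _ => id) fun _ => aemeasurable_id).indepFun hij
    have hlaw : (Measure.pi fun _ : ι => ν).map (fun x => (x i, x j)) = ν.prod ν := by
      rw [(indepFun_iff_map_prod_eq_prod_map_map (measurable_pi_apply i).aemeasurable
        (measurable_pi_apply j).aemeasurable).1 hind,
        (measurePreserving_eval (fun _ : ι => ν) i).map_eq,
        (measurePreserving_eval (fun _ : ι => ν) j).map_eq]
    have hd : MeasurableSet {p : ℝ × ℝ | p.1 = p.2} :=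
      measurableSet_eq_fun measurable_fst measurable_snd
    have hnull : ν.prod ν {p : ℝ × ℝ | p.1 = p.2} = 0 := by
      rw [Measure.measure_prod_null hd]
      refine Eventually.of_forall fun a => ?_
      have : Prod.mk a ⁻¹' {p : ℝ × ℝ | p.1 = p.2} = {a} := by ext; simp [eq_comm]
      simp [this]
    rw [← hlaw, Measure.map_apply (by fun_prop) hd] at hnull
    exact measure_eq_zero_iff_ae_notMem.1 hnull
  have h' : ∀ᵐ x ∂(Measure.pi fun _ : ι => ν), ∀ i j : ι, i ≠ j → x i ≠ x j := by
    rw [ae_all_iff]; intro i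
    rw [ae_all_iff]; intro j
    by_cases hij : i = j
    · exact Eventually.of_forall fun x hx => absurd hij hx
    · filter_upwards [h i j hij] with x hx _ using hx
  filter_upwards [h'] with x hx i j hij
  by_contra hne
  exact hx i j hne hij

/-- Two injective families of reals are, up to a permutation, in the same relative order. -/
theorem exists_perm_le_iff_le {n : ℕ} {x y : Fin n → ℝ} (hx : Function.Injective x)
    (hy : Function.Injective y) :
    ∃ τ : Equiv.Perm (Fin n), ∀ i j, x (τ i) ≤ x (τ j) ↔ y i ≤ y j := by
  have hxs : StrictMono (x ∘ Tuple.sort x) :=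
    (Tuple.monotone_sort x).strictMono_of_injective (hx.comp (Equiv.injective _))
  have hys : StrictMono (y ∘ Tuple.sort y) :=
    (Tuple.monotone_sort y).strictMono_of_injective (hy.comp (Equiv.injective _))
  refine ⟨(Tuple.sort y).symm.trans (Tuple.sort x), fun i j => ?_⟩
  have h1 := hxs.le_iff_le (a := (Tuple.sort y).symm i) (b := (Tuple.sort y).symm j)
  have h2 := hys.le_iff_le (a := (Tuple.sort y).symm i) (b := (Tuple.sort y).symm j)
  simp only [Function.comp_apply, Equiv.apply_symm_apply] at h1 h2
  simp only [Equiv.trans_apply]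
  rw [h1, h2]

/-- For i.i.d. variables with an atomless law, the relative ranks are independent of the order
statistics. -/
theorem pi_inter_eq_mul {n : ℕ} (ν : Measure ℝ) [IsProbabilityMeasure ν] [NullSingletonClass ν]
    {A B : Set (Fin n → ℝ)} (hA : MeasurableSet A) (hB : MeasurableSet B)
    (hAo : ∀ x y : Fin n → ℝ, (∀ i j, x i ≤ x j ↔ y i ≤ y j) → (x ∈ A ↔ y ∈ A))
    (hBs : ∀ (σ : Equiv.Perm (Fin n)) (x : Fin n → ℝ), x ∘ σ ∈ B ↔ x ∈ B) :
    Measure.pi (fun _ => ν) (A ∩ B) = Measure.pi (fun _ => ν) A * Measure.pi (fun _ => ν) B := by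
  classical
  set μ : Measure (Fin n → ℝ) := Measure.pi fun _ => ν
  -- The number of rearrangements of `x` lying in `A`; it is the same for all `x` without ties.
  set k : (Fin n → ℝ) → ENNReal := fun x => ∑ σ : Equiv.Perm (Fin n), A.indicator 1 (x ∘ σ)
  have hk : ∀ x y : Fin n → ℝ, Function.Injective x → Function.Injective y → k x = k y := by
    intro x y hx hy
    obtain ⟨τ, hτ⟩ := exists_perm_le_iff_le hx hy
    have h1 : k x = ∑ σ : Equiv.Perm (Fin n), A.indicator 1 (x ∘ ⇑(τ * σ)) :=
      (Equiv.sum_comp (Equiv.mulLeft τ)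
        fun σ : Equiv.Perm (Fin n) => A.indicator (1 : (Fin n → ℝ) → ENNReal) (x ∘ σ)).symm
    rw [h1]
    refine Finset.sum_congr rfl fun σ _ => ?_
    have : x ∘ ⇑(τ * σ) ∈ A ↔ y ∘ σ ∈ A := hAo _ _ fun i j => hτ (σ i) (σ j)
    simp only [Set.indicator_apply, this, Pi.one_apply]
  set x₀ : Fin n → ℝ := fun i => (i : ℝ)
  have hx₀ : Function.Injective x₀ := fun i j h => Fin.ext (Nat.cast_injective (R := ℝ) h)
  -- Averaging over permutations, which preserve both `μ` and `C`, turns the indicator of `A` into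
  -- the a.e. constant `k`. Comparing `C = B` with `C = univ` eliminates that constant.
  have main : ∀ C : Set (Fin n → ℝ), MeasurableSet C →
      (∀ (σ : Equiv.Perm (Fin n)) (x : Fin n → ℝ), x ∘ σ ∈ C ↔ x ∈ C) →
      (Fintype.card (Equiv.Perm (Fin n)) : ENNReal) * μ (A ∩ C) = k x₀ * μ C := by
    intro C hC hCs
    have hσ : ∀ σ : Equiv.Perm (Fin n),
        μ (A ∩ C) = ∫⁻ x in C, A.indicator 1 (x ∘ σ) ∂μ := by
      intro σ
      have hmp := measurePreserving_comp_perm ν σ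
      have hpre : (fun x : Fin n → ℝ => x ∘ σ) ⁻¹' (A ∩ C) =
          (fun x : Fin n → ℝ => x ∘ σ) ⁻¹' A ∩ C := by
        ext x; simp [hCs]
      rw [← hmp.measure_preimage (hA.inter hC).nullMeasurableSet, hpre]
      have : (fun x : Fin n → ℝ => A.indicator (1 : (Fin n → ℝ) → ENNReal) (x ∘ σ)) =
          ((fun x : Fin n → ℝ => x ∘ σ) ⁻¹' A).indicator 1 := by
        ext x; simp [Set.indicator_apply]
      rw [this, lintegral_indicator_one (hmp.measurable hA),
        Measure.restrict_apply (hmp.measurable hA)]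
    have hsum : (Fintype.card (Equiv.Perm (Fin n)) : ENNReal) * μ (A ∩ C) =
        ∑ σ : Equiv.Perm (Fin n), ∫⁻ x in C, A.indicator 1 (x ∘ σ) ∂μ := by
      rw [← Finset.sum_congr rfl fun σ _ => hσ σ]
      simp
    rw [hsum, ← lintegral_finsetSum]
    · have hae : ∀ᵐ x ∂(μ.restrict C), k x = k x₀ := by
        filter_upwards [ae_restrict_of_ae (ae_injective_pi ν)] with x hx using hk x x₀ hx hx₀
      rw [lintegral_congr_ae hae, setLIntegral_const]
    · intro σ _
      exact (measurable_one.indicator hA).comp (measurePreserving_comp_perm ν σ).measurable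
  have hBk := main B hB hBs
  have hUk := main Set.univ MeasurableSet.univ (fun _ _ => by simp)
  rw [Set.inter_univ, measure_univ, mul_one] at hUk
  rw [← hUk, mul_assoc] at hBk
  exact (ENNReal.mul_right_inj (by simp [Fintype.card_ne_zero]) (by simp)).1 hBk

/-! ### Exponential tails and moments of the counts -/

instance : IsProbabilityMeasure (expMeasure 1) := isProbabilityMeasure_expMeasure one_pos

theorem expMeasure_absolutelyContinuous : expMeasure 1 ≪ volume :=
  withDensity_absolutelyContinuous _ _

instance : NullSingletonClass (expMeasure 1) :=
  ⟨fun _ => expMeasure_absolutelyContinuous (by simp)⟩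

theorem expMeasure_real_Iic (x : ℝ) :
    (expMeasure 1).real (Set.Iic x) = if 0 ≤ x then 1 - Real.exp (-x) else 0 := by
  rw [← cdf_eq_real, cdf_expMeasure_eq one_pos, one_mul]

theorem expMeasure_real_Ici {t : ℝ} (ht : 0 ≤ t) :
    (expMeasure 1).real (Set.Ici t) = Real.exp (-t) := by
  have h := probReal_compl_eq_one_sub (μ := expMeasure 1) (measurableSet_Iic (a := t))
  rw [Set.compl_Iic, expMeasure_real_Iic, if_pos ht, measureReal_congr Ioi_ae_eq_Ici] at h
  rw [h]; ring

theorem expMeasure_real_Ici_le (t : ℝ) : (expMeasure 1).real (Set.Ici t) ≤ Real.exp (-t) := by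
  rcases le_total 0 t with ht | ht
  · exact (expMeasure_real_Ici ht).le
  · exact measureReal_le_one.trans (Real.one_le_exp (by linarith))

/-- The number of coordinates that are at least `t`. -/
def countGE {n : ℕ} (t : ℝ) (x : Fin n → ℝ) : ℕ :=
  (Finset.univ.filter (fun i => t ≤ x i)).card

theorem countGE_comp_perm {n : ℕ} (t : ℝ) (x : Fin n → ℝ) (σ : Equiv.Perm (Fin n)) :
    countGE t (x ∘ σ) = countGE t x :=
  Finset.card_equiv σ (by simp)

theorem coe_countGE {n : ℕ} (t : ℝ) (x : Fin n → ℝ) :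
    (countGE t x : ℝ) = ∑ i, (Set.Ici t).indicator (1 : ℝ → ℝ) (x i) := by
  simp [countGE, Set.indicator_apply, Finset.sum_boole]

theorem measurable_countGE {n : ℕ} (t : ℝ) :
    Measurable (fun x : Fin n → ℝ => (countGE t x : ℝ)) := by
  simp only [coe_countGE]
  exact Finset.measurable_sum _ fun i _ =>
    (measurable_one.indicator measurableSet_Ici).comp (measurable_pi_apply i)

section Moments

variable {n : ℕ} (t : ℝ)

local notation "expPi" => Measure.pi (fun _ : Fin n => expMeasure 1)

theorem integral_indicator_coord (i : Fin n) :
    ∫ x, (Set.Ici t).indicator (1 : ℝ → ℝ) (x i) ∂expPi = (expMeasure 1).real (Set.Ici t) := by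
  have h := measurePreserving_eval (fun _ : Fin n => expMeasure 1) i
  have hm := integral_map (μ := expPi) (f := (Set.Ici t).indicator (1 : ℝ → ℝ)) h.measurable.aemeasurable
    (measurable_one.indicator measurableSet_Ici).aestronglyMeasurable
  rw [h.map_eq, integral_indicator_one measurableSet_Ici] at hm
  exact hm.symm

theorem memLp_indicator_coord (i : Fin n) :
    MemLp (fun x : Fin n → ℝ => (Set.Ici t).indicator (1 : ℝ → ℝ) (x i)) 2 expPi := by
  refine MemLp.of_bound ((measurable_one.indicator measurableSet_Ici).comp
    (measurable_pi_apply i)).aestronglyMeasurable 1 (Eventually.of_forall fun x => ?_)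
  rw [Set.indicator_apply]; split_ifs <;> simp

theorem integrable_countGE : Integrable (fun x : Fin n → ℝ => (countGE t x : ℝ)) expPi := by
  simp only [coe_countGE]
  exact integrable_finsetSum _ fun i _ => (memLp_indicator_coord t i).integrable (by norm_num)

theorem integral_countGE :
    ∫ x, (countGE t x : ℝ) ∂expPi = n * (expMeasure 1).real (Set.Ici t) := by
  simp only [coe_countGE]
  rw [integral_finsetSum _ fun i _ => (memLp_indicator_coord t i).integrable (by norm_num)]
  simp [integral_indicator_coord]

theorem variance_countGE_le :
    variance (fun x : Fin n → ℝ => (countGE t x : ℝ)) expPi ≤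
      n * (expMeasure 1).real (Set.Ici t) := by
  have hsum : (fun x : Fin n → ℝ => (countGE t x : ℝ)) =
      ∑ i, fun x : Fin n → ℝ => (Set.Ici t).indicator (1 : ℝ → ℝ) (x i) := by
    ext x; rw [coe_countGE, Finset.sum_apply]
  have hind : iIndepFun (fun (i : Fin n) (x : Fin n → ℝ) =>
      (Set.Ici t).indicator (1 : ℝ → ℝ) (x i)) expPi :=
    iIndepFun_pi (X := fun _ => (Set.Ici t).indicator (1 : ℝ → ℝ))
      fun _ => (measurable_one.indicator measurableSet_Ici).aemeasurable
  rw [hsum, IndepFun.variance_sum (fun i _ => memLp_indicator_coord t i)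
    fun i _ j _ hij => hind.indepFun hij]
  refine (Finset.sum_le_sum (g := fun _ => (expMeasure 1).real (Set.Ici t)) fun i _ => ?_).trans
    (by simp)
  refine (variance_le_expectation_sq (memLp_indicator_coord t i).aestronglyMeasurable).trans ?_
  rw [← integral_indicator_coord t i]
  refine (integral_congr_ae (Eventually.of_forall fun x => ?_)).le
  simp only [Pi.pow_apply, Set.indicator_apply]
  split_ifs <;> simp

theorem measure_le_countGE {r : ℕ} (hr : 1 ≤ r) :
    expPi {x | r ≤ countGE t x} ≤ ENNReal.ofReal (n * Real.exp (-t) / r) := by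
  have hr' : (0 : ℝ) < r := by exact_mod_cast hr
  have h := mul_meas_ge_le_integral_of_nonneg (μ := expPi)
    (Eventually.of_forall fun x : Fin n → ℝ => (countGE t x).cast_nonneg (α := ℝ))
    (integrable_countGE t) (r : ℝ)
  rw [integral_countGE] at h
  simp only [Nat.cast_le] at h
  rw [← ofReal_measureReal]
  refine ENNReal.ofReal_le_ofReal ?_
  rw [le_div_iff₀ hr', mul_comm]
  exact h.trans (mul_le_mul_of_nonneg_left (expMeasure_real_Ici_le t) n.cast_nonneg)

theorem measure_countGE_lt {t : ℝ} (ht : 0 ≤ t) {r : ℕ} (hr : (r : ℝ) < n * Real.exp (-t)) :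
    expPi {x | countGE t x < r} ≤
      ENNReal.ofReal (n * Real.exp (-t) / (n * Real.exp (-t) - r) ^ 2) := by
  have hmem : MemLp (fun x : Fin n → ℝ => (countGE t x : ℝ)) 2 expPi := by
    simp only [coe_countGE]
    exact memLp_finsetSum _ fun i _ => memLp_indicator_coord t i
  have h := meas_ge_le_variance_div_sq hmem (sub_pos.2 hr)
  refine (measure_mono fun x hx => ?_).trans (h.trans (ENNReal.ofReal_le_ofReal ?_))
  · have hx' : (countGE t x : ℝ) < r := by exact_mod_cast (show countGE t x < r from hx)
    rw [Set.mem_ofPred_eq, integral_countGE, expMeasure_real_Ici ht, abs_sub_comm]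
    exact (sub_le_sub_left hx'.le _).trans (le_abs_self _)
  · have := variance_countGE_le (n := n) t
    rw [expMeasure_real_Ici ht] at this
    gcongr

end Moments

/-! ### Concentration of the order statistics -/

/-- The `r`-th largest of `n` values deviates from `log (n / r)` by more than `K`. -/
def deviationSet (n r : ℕ) (K : ℝ) : Set (Fin n → ℝ) :=
  {x | r ≤ countGE (Real.log n - Real.log r + K) x} ∪
    {x | 0 < Real.log n - Real.log r - K ∧ countGE (Real.log n - Real.log r - K) x < r}

theorem measurableSet_deviationSet (n r : ℕ) (K : ℝ) : MeasurableSet (deviationSet n r K) := by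
  have h1 (t : ℝ) : {x : Fin n → ℝ | r ≤ countGE t x} =
      (fun x : Fin n → ℝ => (countGE t x : ℝ)) ⁻¹' Set.Ici (r : ℝ) := by
    ext; simp
  have h2 (t : ℝ) : {x : Fin n → ℝ | countGE t x < r} =
      (fun x : Fin n → ℝ => (countGE t x : ℝ)) ⁻¹' Set.Iio (r : ℝ) := by
    ext; simp
  have h1' (t : ℝ) : MeasurableSet {x : Fin n → ℝ | r ≤ countGE t x} := by
    rw [h1]; exact measurable_countGE _ measurableSet_Ici
  have h2' (t : ℝ) : MeasurableSet {x : Fin n → ℝ | countGE t x < r} := by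
    rw [h2]; exact measurable_countGE _ measurableSet_Iio
  exact (h1' _).union ((MeasurableSet.const _).inter (h2' _))

/-- At the upper level `n * exp (-t)` equals `r * exp (-K)`, and Markov contributes `exp (-K)`. At a
positive lower level the mean count is `r * exp K`, and Chebyshev contributes `4 * exp (-K)`. -/
theorem measure_deviationSet_le {n r : ℕ} (hn : 1 ≤ n) (hr : 1 ≤ r) {K : ℝ} (hK : 1 ≤ K) :
    Measure.pi (fun _ : Fin n => expMeasure 1) (deviationSet n r K) ≤
      ENNReal.ofReal (5 * Real.exp (-K)) := by
  have hn' : (0 : ℝ) < n := by exact_mod_cast hn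
  have hr' : (1 : ℝ) ≤ r := by exact_mod_cast hr
  have hexp (a : ℝ) : (n : ℝ) * Real.exp (-(Real.log n - Real.log r + a)) =
      r * Real.exp (-a) := by
    rw [show -(Real.log n - Real.log r + a) = Real.log r - Real.log n + -a by ring, Real.exp_add,
      Real.exp_sub, Real.exp_log hn', Real.exp_log (by linarith)]
    field_simp
  have hexp' := hexp (-K)
  rw [neg_neg, ← sub_eq_add_neg] at hexp'
  have hE : 2 ≤ Real.exp K := by linarith [Real.add_one_le_exp K]
  have hEinv : Real.exp (-K) = (Real.exp K)⁻¹ := Real.exp_neg K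
  have hsplit : 5 * Real.exp (-K) = Real.exp (-K) + 4 * Real.exp (-K) := by ring
  rw [hsplit, ENNReal.ofReal_add (by positivity) (by positivity)]
  refine (measure_union_le _ _).trans (add_le_add ?_ ?_)
  · refine (measure_le_countGE _ hr).trans (ENNReal.ofReal_le_ofReal ?_)
    rw [hexp, mul_div_assoc, mul_comm, div_mul_cancel₀ _ (by linarith)]
  · by_cases hs : 0 < Real.log n - Real.log r - K
    · have hlt : (r : ℝ) < n * Real.exp (-(Real.log n - Real.log r - K)) := by
        rw [hexp']; nlinarith
      simp only [hs, true_and]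
      refine (measure_countGE_lt hs.le hlt).trans (ENNReal.ofReal_le_ofReal ?_)
      rw [hexp', hEinv]
      set E := Real.exp K
      -- Since `E ≥ 2`, the gap between the mean and `r` is at least half the mean.
      have h1 : (r : ℝ) * (E / 2) ≤ r * E - r := by nlinarith
      have h2 : ((r : ℝ) * (E / 2)) ^ 2 ≤ (r * E - r) ^ 2 := by gcongr
      calc (r : ℝ) * E / (r * E - r) ^ 2 ≤ r * E / (r * (E / 2)) ^ 2 := by gcongr
        _ = 4 * E⁻¹ / r := by field_simp; norm_num
        _ ≤ 4 * E⁻¹ := div_le_self (by positivity) hr'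
    · simp [hs]

/-! ### The event that candidate `n` is the `m`-th accepted -/

theorem measurable_acceptedCount {α : Type*} [MeasurableSpace α] (r : ℕ → ℕ) {f : α → ℕ → ℝ}
    (hf : ∀ i, Measurable fun a => f a i) (n : ℕ) :
    Measurable fun a => acceptedCount r (f a) n := by
  induction n with
  | zero => exact measurable_const
  | succ n ih =>
    simp only [acceptedCount]
    refine ih.add (Measurable.ite (measurableSet_lt ?_ ((measurable_of_countable r).comp ih))
      measurable_const measurable_const)
    simp only [Finset.card_filter]
    exact Finset.measurable_sum _ fun i _ =>
      Measurable.ite (measurableSet_le (hf n) (hf i)) measurable_const measurable_const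

/-- Extension of a finite sequence by `0`. -/
def extendZero {n : ℕ} (y : Fin n → ℝ) (i : ℕ) : ℝ := if h : i < n then y ⟨i, h⟩ else 0

theorem measurable_extendZero {n : ℕ} (i : ℕ) :
    Measurable fun y : Fin n → ℝ => extendZero y i := by
  unfold extendZero
  split_ifs with h
  · exact measurable_pi_apply _
  · exact measurable_const

/-- The values of the first `n` candidates for which candidate `n` is the `m`-th accepted one. -/
def hireSet (r : ℕ → ℕ) (m n : ℕ) : Set (Fin n → ℝ) :=
  {y | acceptedCount r (extendZero y) n = m ∧ ∀ k < n, acceptedCount r (extendZero y) k < m}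

theorem measurableSet_hireSet (r : ℕ → ℕ) (m n : ℕ) : MeasurableSet (hireSet r m n) := by
  have h := fun k => measurable_acceptedCount r (measurable_extendZero (n := n)) k
  have h2 : MeasurableSet {y : Fin n → ℝ | ∀ k < n, acceptedCount r (extendZero y) k < m} := by
    simp only [Set.ofPred_forall]
    exact MeasurableSet.iInter fun k => MeasurableSet.iInter fun _ =>
      measurableSet_lt (h k) measurable_const
  exact (measurableSet_eq_fun (h n) measurable_const).inter h2

theorem mem_hireSet_of_le_iff_le (r : ℕ → ℕ) (m : ℕ) {n : ℕ} (x y : Fin n → ℝ)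
    (h : ∀ i j, x i ≤ x j ↔ y i ≤ y j) : x ∈ hireSet r m n ↔ y ∈ hireSet r m n := by
  -- Up to time `n` only coordinates below `n` are read, so the padding never matters.
  have key : ∀ k ≤ n, acceptedCount r (extendZero x) k = acceptedCount r (extendZero y) k := by
    intro k hk
    refine acceptedCount_congr r k fun i hi j hj => ?_
    simp only [extendZero, dif_pos (hi.trans_le hk), dif_pos (hj.trans_le hk)]
    exact h _ _
  refine and_congr (by rw [key n le_rfl]) (forall₂_congr fun k hk => by rw [key k hk.le])

theorem mem_hireSet_restrict_iff (r : ℕ → ℕ) (m n : ℕ) (x : ℕ → ℝ) :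
    (fun i : Fin n => x i) ∈ hireSet r m n ↔
      acceptedCount r x n = m ∧ ∀ k < n, acceptedCount r x k < m := by
  have key : ∀ k ≤ n,
      acceptedCount r (extendZero fun i : Fin n => x i) k = acceptedCount r x k := by
    intro k hk
    refine acceptedCount_congr r k fun i hi j hj => ?_
    simp only [extendZero, dif_pos (hi.trans_le hk), dif_pos (hj.trans_le hk)]
  exact and_congr (by rw [key n le_rfl]) (forall₂_congr fun k hk => by rw [key k hk.le])

theorem comp_perm_mem_deviationSet {n : ℕ} (r : ℕ) (K : ℝ) (σ : Equiv.Perm (Fin n))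
    (x : Fin n → ℝ) : x ∘ σ ∈ deviationSet n r K ↔ x ∈ deviationSet n r K := by
  simp only [deviationSet, Set.mem_union, Set.mem_ofPred_eq, countGE_comp_perm]

theorem card_filter_range_eq_countGE (n : ℕ) (t : ℝ) (x : ℕ → ℝ) :
    ((Finset.range n).filter (fun i => t ≤ x i)).card = countGE t (fun i : Fin n => x i) := by
  rw [countGE, Finset.card_filter, Finset.card_filter, Finset.sum_range]

section Paths

variable {r : ℕ → ℕ} {x : ℕ → ℝ}

theorem restrict_mem_hireSet (hr : IsAdmissible r) (hpos : ∀ i, 0 < x i)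
    (hx : ∀ (N : ℕ) (c : ℝ), ∃ i, N ≤ i ∧ c < x i) (m : ℕ+) :
    (fun i : Fin (hireIndex r x m) => x i) ∈ hireSet r m (hireIndex r x m) := by
  rw [mem_hireSet_restrict_iff]
  refine ⟨acceptedCount_hireIndex hr hpos hx m, fun k hk => ?_⟩
  obtain ⟨l, hl⟩ := Nat.exists_eq_succ_of_ne_zero m.ne_zero
  rw [hl, Nat.succ_eq_add_one, hireIndex_succ] at hk
  have := acceptedCount_mono r x (Nat.lt_succ_iff.1 hk)
  rw [acceptedCount_nextHire hr hpos hx] at this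
  omega

theorem le_hireIndex (hr : IsAdmissible r) (hpos : ∀ i, 0 < x i)
    (hx : ∀ (N : ℕ) (c : ℝ), ∃ i, N ≤ i ∧ c < x i) (m : ℕ) : m ≤ hireIndex r x m := by
  conv_lhs => rw [← acceptedCount_hireIndex hr hpos hx m]
  exact acceptedCount_le r x _

theorem restrict_mem_deviationSet (hr : IsAdmissible r) (hpos : ∀ i, 0 < x i)
    (hx : ∀ (N : ℕ) (c : ℝ), ∃ i, N ≤ i ∧ c < x i) (m : ℕ+) {K : ℝ} (hK : 1 ≤ K)
    (h : K < |Real.log (hireIndex r x m : ℝ) - Real.log (r m : ℝ) - threshold r x m|) :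
    (fun i : Fin (hireIndex r x m) => x i) ∈ deviationSet (hireIndex r x m) (r m) K := by
  set n := hireIndex r x m with hn
  have key {t : ℝ} (ht : 0 < t) : t ≤ threshold r x m ↔ r m ≤ countGE t (fun i : Fin n => x i) := by
    rw [le_threshold_iff hr hpos hx le_rfl (nextHire_mem hx m).1 ht, card_filter_range_eq_countGE]
  have hmn : (m : ℕ) ≤ n := le_hireIndex hr hpos hx m
  have hm := m.pos
  have hn0 : (0 : ℝ) < n := by exact_mod_cast hm.trans_le hmn
  have hr0 : (0 : ℝ) < r m := by exact_mod_cast hr.one_le m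
  -- From `r m ≤ m + 1` and `1 ≤ m ≤ n`. With `log 2 < 1 ≤ K` this makes the upper level `log n -
  -- log (r m) + K` positive, as `key` requires.
  have hrn : (r m : ℝ) ≤ 2 * n := by
    have := hr.le_add_one m
    exact_mod_cast (show r m ≤ 2 * n by omega)
  have hlog : Real.log (r m) ≤ Real.log 2 + Real.log n := by
    rw [← Real.log_mul two_ne_zero hn0.ne']
    exact Real.log_le_log hr0 hrn
  have hlog2 := Real.log_two_lt_d9
  rcases lt_abs.1 h with h | h
  -- A downward deviation forces the lower level above the nonnegative threshold, hence to be
  -- positive.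
  · refine Or.inr ⟨(threshold_nonneg hpos m).trans_lt (by linarith : threshold r x m < _), ?_⟩
    rw [← not_le, ← key ((threshold_nonneg hpos m).trans_lt (by linarith)), not_le]
    linarith
  · exact Or.inl ((key (by linarith)).1 (by linarith))

end Paths

/-! ### Almost sure properties and tightness -/

section Probability

variable {Ω : Type*} [MeasurableSpace Ω] {P : Measure Ω}
  {r : ℕ → ℕ} {X : ℕ → Ω → ℝ}

theorem ae_pos (hlaw : ∀ n, HasLaw (X n) (expMeasure 1) P) : ∀ᵐ ω ∂P, ∀ n, 0 < X n ω := by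
  rw [ae_all_iff]
  intro n
  have h0 : expMeasure 1 (Set.Iic 0) = 0 := by
    have := expMeasure_real_Iic 0
    rw [if_pos le_rfl, neg_zero, Real.exp_zero, sub_self] at this
    exact (measureReal_eq_zero_iff).1 this
  rw [← (hlaw n).map_eq, Measure.map_apply_of_aemeasurable (hlaw n).aemeasurable
    measurableSet_Iic] at h0
  filter_upwards [measure_eq_zero_iff_ae_notMem.1 h0] with ω hω
  exact not_le.1 hω

theorem ae_exists_gt [IsProbabilityMeasure P]
    (hlaw : ∀ n, HasLaw (X n) (expMeasure 1) P) (hindep : iIndepFun X P) :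
    ∀ᵐ ω ∂P, ∀ (N : ℕ) (c : ℝ), ∃ i, N ≤ i ∧ c < X i ω := by
  have main : ∀ᵐ ω ∂P, ∀ N c : ℕ, ∃ i, N ≤ i ∧ (c : ℝ) < X i ω := by
    rw [ae_all_iff]; intro N
    rw [ae_all_iff]; intro c
    rw [ae_iff]
    set q := expMeasure 1 (Set.Iic (c : ℝ)) with hq
    have hq1 : q < 1 := by
      have h := expMeasure_real_Iic c
      rw [if_pos c.cast_nonneg] at h
      rw [hq, ← ofReal_measureReal, h, ENNReal.ofReal_lt_one]
      linarith [Real.exp_pos (-(c : ℝ))]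
    -- By independence, `k` consecutive candidates from position `N` on all stay at or below `c`
    -- with probability `q ^ k`.
    have hle (k : ℕ) : P {ω | ¬∃ i, N ≤ i ∧ (c : ℝ) < X i ω} ≤ q ^ k := by
      have hinj : Function.Injective fun i : Fin k => N + (i : ℕ) :=
        fun i j h => Fin.ext (Nat.add_left_cancel h)
      have hl := (hindep.precomp hinj).hasLaw_pi fun i : Fin k => hlaw (N + (i : ℕ))
      have hms : MeasurableSet (Set.univ.pi fun _ : Fin k => Set.Iic (c : ℝ)) :=
        MeasurableSet.univ_pi fun _ => measurableSet_Iic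
      have hpi : Measure.pi (fun _ : Fin k => expMeasure 1)
          (Set.univ.pi fun _ => Set.Iic (c : ℝ)) = q ^ k := by
        rw [Measure.pi_pi]; simp [hq]
      rw [← hpi, ← hl.map_eq, Measure.map_apply_of_aemeasurable hl.aemeasurable hms]
      refine measure_mono fun ω hω i _ => ?_
      by_contra hlt
      exact hω ⟨N + i, Nat.le_add_right _ _, not_le.1 hlt⟩
    exact le_antisymm (ge_of_tendsto' (ENNReal.tendsto_pow_atTop_nhds_zero_of_lt_one hq1) hle)
      zero_le
  filter_upwards [main] with ω hω N c
  obtain ⟨k, hk⟩ := exists_nat_ge c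
  obtain ⟨i, hi, hi'⟩ := hω N k
  exact ⟨i, hi, hk.trans_lt hi'⟩

/-- Split by the value `n` of `N_m`: on each piece independence factors out the deviation
probability, and the remaining weights sum to at most `1`. -/
theorem measure_lt_abs_le [IsProbabilityMeasure P] (hr : IsAdmissible r)
    (hlaw : ∀ n, HasLaw (X n) (expMeasure 1) P)
    (hindep : iIndepFun X P) (m : ℕ+) {K : ℝ} (hK : 1 ≤ K) :
    P {ω | K < |Real.log (hireIndex r (fun n => X n ω) m : ℝ) - Real.log (r m : ℝ) -
      threshold r (fun n => X n ω) m|} ≤ ENNReal.ofReal (5 * Real.exp (-K)) := by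
  set T : (n : ℕ) → Ω → Fin n → ℝ := fun n ω i => X i ω
  have hT (n : ℕ) : HasLaw (T n) (Measure.pi fun _ => expMeasure 1) P :=
    (hindep.precomp (Fin.val_injective (n := n))).hasLaw_pi fun i => hlaw i
  have hpre (n : ℕ) {C : Set (Fin n → ℝ)} (hC : MeasurableSet C) :
      P (T n ⁻¹' C) = Measure.pi (fun _ => expMeasure 1) C := by
    rw [← (hT n).map_eq, Measure.map_apply_of_aemeasurable (hT n).aemeasurable hC]
  have hA := measurableSet_hireSet r m
  have hB (n : ℕ) := measurableSet_deviationSet n (r m) K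
  have hsub : P {ω | K < |Real.log (hireIndex r (fun n => X n ω) m : ℝ) - Real.log (r m : ℝ) -
      threshold r (fun n => X n ω) m|} ≤
      P (⋃ n, T n ⁻¹' (hireSet r m n ∩ deviationSet n (r m) K)) := by
    refine measure_mono_ae ?_
    filter_upwards [ae_pos hlaw, ae_exists_gt hlaw hindep] with ω hpos hx hω
    exact Set.mem_iUnion.2 ⟨hireIndex r (fun n => X n ω) m,
      restrict_mem_hireSet hr hpos hx m, restrict_mem_deviationSet hr hpos hx m hK hω⟩
  have hterm (n : ℕ) : P (T n ⁻¹' (hireSet r m n ∩ deviationSet n (r m) K)) ≤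
      P (T n ⁻¹' hireSet r m n) * ENNReal.ofReal (5 * Real.exp (-K)) := by
    rw [hpre n ((hA n).inter (hB n)), hpre n (hA n), pi_inter_eq_mul _ (hA n) (hB n)
      (fun x y => mem_hireSet_of_le_iff_le r m x y) (comp_perm_mem_deviationSet (r m) K)]
    rcases Nat.eq_zero_or_pos n with rfl | hn
    -- The concentration bound needs `n ≥ 1`; no acceptance has happened at time `0`, whereas `m ≥
    -- 1`.
    · have : hireSet r m 0 = ∅ := by
        refine Set.eq_empty_of_forall_notMem fun y hy => m.ne_zero hy.1.symm
      simp [this]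
    · gcongr
      exact measure_deviationSet_le hn (hr.one_le m) hK
  -- The count reaches `m` for the first time at only one index.
  have hdisj : Pairwise (Function.onFun (AEDisjoint P) fun n => T n ⁻¹' hireSet r m n) := by
    intro n n' hne
    refine Disjoint.aedisjoint (Set.disjoint_left.2 fun ω h h' => ?_)
    have h := (mem_hireSet_restrict_iff r m n fun i => X i ω).1 h
    have h' := (mem_hireSet_restrict_iff r m n' fun i => X i ω).1 h'
    rcases hne.lt_or_gt with hlt | hlt
    · exact (h'.2 n hlt).ne h.1
    · exact (h.2 n' hlt).ne h'.1
  have hsum : ∑' n, P (T n ⁻¹' hireSet r m n) ≤ 1 := by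
    rw [← measure_univ (μ := P)]
    exact tsum_measure_le_measure_univ
      (fun n => (hT n).aemeasurable.nullMeasurable (hA n)) hdisj
  calc _ ≤ _ := hsub
    _ ≤ ∑' n, P (T n ⁻¹' (hireSet r m n ∩ deviationSet n (r m) K)) := measure_iUnion_le _
    _ ≤ ∑' n, P (T n ⁻¹' hireSet r m n) * ENNReal.ofReal (5 * Real.exp (-K)) :=
      ENNReal.tsum_le_tsum hterm
    _ = (∑' n, P (T n ⁻¹' hireSet r m n)) * ENNReal.ofReal (5 * Real.exp (-K)) :=
      ENNReal.tsum_mul_right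
    _ ≤ 1 * ENNReal.ofReal (5 * Real.exp (-K)) := by gcongr
    _ = _ := one_mul _

theorem stochasticallyBounded_log_hireIndex [IsProbabilityMeasure P] (hr : IsAdmissible r)
    (hlaw : ∀ n, HasLaw (X n) (expMeasure 1) P) (hindep : iIndepFun X P) :
    StochasticallyBounded P (fun (m : ℕ+) ω =>
      Real.log (hireIndex r (fun n => X n ω) m : ℝ) - Real.log (r m : ℝ) -
        threshold r (fun n => X n ω) m) := by
  have hlim : Tendsto (fun K : ℝ => ENNReal.ofReal (5 * Real.exp (-K))) atTop (𝓝 0) := by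
    have h : Tendsto (fun K : ℝ => 5 * Real.exp (-K)) atTop (𝓝 (5 * 0)) :=
      Real.tendsto_exp_neg_atTop_nhds_zero.const_mul 5
    rw [mul_zero] at h
    simpa using ENNReal.tendsto_ofReal h
  refine tendsto_of_tendsto_of_tendsto_of_le_of_le' tendsto_const_nhds hlim
    (Eventually.of_forall fun _ => zero_le) ?_
  filter_upwards [eventually_ge_atTop 1] with K hK
  exact iSup_le fun m => measure_lt_abs_le hr hlaw hindep m hK

end Probability

end Hiring

end

theorem mainTheorem6 {Ω : Type*} [MeasurableSpace Ω] (P : Measure Ω) [IsProbabilityMeasure P]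
    (r : ℕ → ℕ) (hr : Hiring.IsAdmissible r)
    (X : ℕ → Ω → ℝ) (hlaw : ∀ n, HasLaw (X n) (expMeasure 1) P) (hindep : iIndepFun X P) :
    -- almost surely, after every acceptance there is a later one, so all `N_m` are defined
    (∀ᵐ ω ∂P, ∀ m : ℕ, ∃ i : ℕ, Hiring.hireIndex r (fun n => X n ω) m ≤ i ∧
      Hiring.threshold r (fun n => X n ω) m < X i ω) ∧
    -- `N_m = r(m) * exp (Y_m + O_p(1))`
    (∃ Z : ℕ+ → Ω → ℝ, Hiring.StochasticallyBounded P Z ∧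
      ∀ m : ℕ+, ∀ᵐ ω ∂P, (Hiring.hireIndex r (fun n => X n ω) m : ℝ) =
        (r m : ℝ) * Real.exp (Hiring.threshold r (fun n => X n ω) m + Z m ω)) ∧
    -- `log N_m - log r(m) - Y_m = O_p(1)`
    Hiring.StochasticallyBounded P (fun (m : ℕ+) ω =>
      Real.log (Hiring.hireIndex r (fun n => X n ω) m : ℝ) - Real.log (r m : ℝ) -
        Hiring.threshold r (fun n => X n ω) m) := by
  have hZ := Hiring.stochasticallyBounded_log_hireIndex hr hlaw hindep
  refine ⟨?_, ⟨_, hZ, fun m => ?_⟩, hZ⟩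
  · filter_upwards [Hiring.ae_exists_gt hlaw hindep] with ω hω m using hω _ _
  · filter_upwards [Hiring.ae_pos hlaw, Hiring.ae_exists_gt hlaw hindep] with ω hpos hx
    have hN : (0 : ℝ) < Hiring.hireIndex r (fun n => X n ω) m := by
      exact_mod_cast m.pos.trans_le (Hiring.le_hireIndex hr hpos hx m)
    have hrm : (0 : ℝ) < r m := by exact_mod_cast hr.one_le m
    rw [add_sub_cancel, Real.exp_sub, Real.exp_log hN, Real.exp_log hrm, mul_div_cancel₀ _ hrm.ne']
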